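/- Let $\mathbb C$ be a pretopos (a Barr-exact category with finite sums that is extensive), let $\mathsf{PreOrd}(\mathbb C)$ be the category of internal preorders in $\mathbb C$. An object of $\mathsf{PreOrd}(\mathbb C)$ is trivial if it is both an equivalence relation and a partial order (i.e. a discrete preorder), and a morphism is trivial if it factors through a trivial object. A $\mathcal Z$-kernel of $f\colon A'\to B$ is a morphism $k\colon K\to A'$ such that $fk$ is trivial and every $\lambda$ with $f\lambda$ trivial factors uniquely through $k$. Let $\mathsf{PaPreOrd}(\mathbb C)$ be the category with the same objects, whose morphisms $A\to B$ are the isomorphism classes of pairs $(\alpha,f)$ with $\alpha\colon A'\to A$ a complemented subobject and $f\colon A'\to B$ a morphism in $\mathsf{PreOrd}(\mathbb C)$, composed by pullback. Let $\mathsf{Stab}(\mathbb C)$ be its quotient by the congruence identifying $(\alpha_1,f_1)$ and $(\alpha_2,f_2)$, with $\alpha_i\colon A_i\to A$ and $f_i\colon A_i\to B$, whenever there is a complemented subobject $A_0$ of $A$, contained in $A_1$ and $A_2$ as a complemented subobject, such that $f_1$ and $f_2$ agree on $A_0$ and each $f_i$ is trivial on the complement of $A_0$ in $A_i$. Write $\langle\alpha,f\rangle$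 for the class of $(\alpha,f)$ and $\Sigma\colon\mathsf{PreOrd}(\mathbb C)\to\mathsf{Stab}(\mathbb C)$, $\Sigma(f)=\langle 1,f\rangle$, for the canonical functor. The category $\mathsf{Stab}(\mathbb C)$ is pointed, with zero object the image under $\Sigma$ of the initial object. Then $\mathsf{Stab}(\mathbb C)$ has kernels. More precisely, let $\langle\alpha,f\rangle\colon A\to B$ be a morphism of $\mathsf{Stab}(\mathbb C)$, with $\alpha\colon A'\to A$ a complemented subobject and $f\colon A'\to B$ in $\mathsf{PreOrd}(\mathbb C)$, and let $\alpha^c\colon A'^c\to A$ be the complement of $\alpha$. Then $[\alpha,\alpha^c]\colon A'\amalg A'^c\to A$ is an isomorphism in $\mathsf{PreOrd}(\mathbb C)$, $f$ has a $\mathcal Z$-kernel in $\mathsf{PreOrd}(\mathbb C)$, and for every $\mathcal Z$-kernel $k\colon K\to A'$ of $f$ the morphism $$\Sigma(k\amalg 1_{A'^c})\colon K\amalg A'^c\longrightarrow A'\amalg A'^c\cong A$$ (where the isomorphism is $[\alpha,\alpha^c]$) is a kernel of $\langle\alpha,f\rangle$ in $\mathsf{Stab}(\mathbb C)$. -/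

import Mathlib

open CategoryTheory CategoryTheory.Limits

universe v u


namespace StableCat

/-- A pretopos: a Barr-exact category (regular, and every internal equivalence relation is a kernel
pair) which has finite sums and is extensive. -/
class Pretopos (C : Type u) [Category.{v} C] : Prop extends Regular C, FinitaryExtensive C where
  effective : ∀ {R X : C} (p₁ p₂ : R ⟶ X) [IsEquivalenceRelation p₁ p₂],
    ∃ (Y : C) (f : X ⟶ Y), IsKernelPair f p₁ p₂

section generic

variable {C : Type u} [Category.{v} C]

lemma cofan_desc {X Y S Z : C} {i : X ⟶ S} {j : Y ⟶ S} (h : IsColimit (BinaryCofan.mk i j))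
    (a : X ⟶ Z) (b : Y ⟶ Z) : ∃ l : S ⟶ Z, i ≫ l = a ∧ j ≫ l = b :=
  ⟨(BinaryCofan.IsColimit.desc' h a b).1, (BinaryCofan.IsColimit.desc' h a b).2.1,
    (BinaryCofan.IsColimit.desc' h a b).2.2⟩

lemma cofan_ext {X Y S Z : C} {i : X ⟶ S} {j : Y ⟶ S} (h : IsColimit (BinaryCofan.mk i j))
    {a b : S ⟶ Z} (h₁ : i ≫ a = i ≫ b) (h₂ : j ≫ a = j ≫ b) : a = b :=
  BinaryCofan.IsColimit.hom_ext h h₁ h₂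

lemma isPullback_id_left {A B : C} (g : A ⟶ B) : IsPullback (𝟙 A) g g (𝟙 B) :=
  IsPullback.of_horiz_isIso ⟨by simp⟩

lemma isPullback_id_right {A B : C} (g : A ⟶ B) : IsPullback g (𝟙 A) (𝟙 B) g :=
  IsPullback.of_vert_isIso ⟨by simp⟩

variable [FinitaryExtensive C]

lemma isPullback_coprod_map {X Y X' Y' : C} (g : X ⟶ X') (h : Y ⟶ Y') :
    IsPullback coprod.inl g (coprod.map g h) coprod.inl ∧
      IsPullback coprod.inr h (coprod.map g h) coprod.inr := by
  have := (BinaryCofan.isVanKampen_iff (BinaryCofan.mk (coprod.inl : X' ⟶ X' ⨿ Y') coprod.inr)).1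
    (FinitaryExtensive.vanKampen _ (coprodIsCoprod X' Y'))
    (BinaryCofan.mk (coprod.inl : X ⟶ X ⨿ Y) coprod.inr) g h (coprod.map g h)
    (coprod.inl_map g h).symm (coprod.inr_map g h).symm
  exact this.1 ⟨coprodIsCoprod X Y⟩

lemma exists_decomposition [HasPullbacks C] {X Y T : C} (q : T ⟶ X ⨿ Y) :
    ∃ (T₁ T₂ : C) (i₁ : T₁ ⟶ T) (i₂ : T₂ ⟶ T) (q₁ : T₁ ⟶ X) (q₂ : T₂ ⟶ Y),
      i₁ ≫ q = q₁ ≫ coprod.inl ∧ i₂ ≫ q = q₂ ≫ coprod.inr ∧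
      Nonempty (IsColimit (BinaryCofan.mk i₁ i₂)) := by
  have := (BinaryCofan.isVanKampen_iff (BinaryCofan.mk (coprod.inl : X ⟶ X ⨿ Y) coprod.inr)).1
    (FinitaryExtensive.vanKampen _ (coprodIsCoprod X Y))
    (BinaryCofan.mk (pullback.fst q coprod.inl) (pullback.fst q coprod.inr))
    (pullback.snd q coprod.inl) (pullback.snd q coprod.inr) q
    pullback.condition.symm pullback.condition.symm
  exact ⟨_, _, _, _, _, _, pullback.condition, pullback.condition,
    this.2 ⟨IsPullback.of_hasPullback _ _, IsPullback.of_hasPullback _ _⟩⟩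

end generic

section complements

variable {C : Type u} [Category.{v} C]

/-- `α` and `α'` are complementary subobjects of `B`: their intersection is the initial object and
their union is `B`, i.e. every subobject of `B` containing both is all of `B`. -/
structure IsComplement {A A' B : C} (α : A ⟶ B) (α' : A' ⟶ B) : Prop where
  mono_left : Mono α
  mono_right : Mono α'
  inter : ∃ (P : C) (p : P ⟶ A) (p' : P ⟶ A'), IsPullback p p' α α' ∧ Nonempty (IsInitial P)
  union : ∀ ⦃S : C⦄ (m : S ⟶ B), Mono m → (∃ s : A ⟶ S, s ≫ m = α) →
    (∃ s' : A' ⟶ S, s' ≫ m = α') → IsIso m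

/-- A complemented subobject. -/
def IsComplemented {A B : C} (α : A ⟶ B) : Prop :=
  ∃ (A' : C) (α' : A' ⟶ B), IsComplement α α'

variable [FinitaryExtensive C] [HasPullbacks C]

lemma mono_desc {A A' B P : C} {α : A ⟶ B} {α' : A' ⟶ B} [Mono α] [Mono α'] {p : P ⟶ A}
    {p' : P ⟶ A'} (h : IsPullback p p' α α') (hP : IsInitial P) : Mono (coprod.desc α α') := by
  constructor
  intro T s t e
  have key : ∀ {T : C} (s t : T ⟶ A ⨿ A') (a : T ⟶ A) (a' : T ⟶ A'), s = a ≫ coprod.inl →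
      t = a' ≫ coprod.inr → s ≫ coprod.desc α α' = t ≫ coprod.desc α α' → s = t := by
    intro T s t a a' hs ht e
    subst hs ht
    have e' : a ≫ α = a' ≫ α' := by
      simpa [coprod.inl_desc, coprod.inr_desc, coprod.inl_desc_assoc, coprod.inr_desc_assoc] using e
    have := hP.isIso_to (h.lift a a' e')
    exact (hP.ofIso (asIso (h.lift a a' e')).symm).hom_ext _ _
  obtain ⟨T₁, T₂, i₁, i₂, q₁, q₂, e₁, e₂, ⟨hT⟩⟩ := exists_decomposition s
  apply cofan_ext hT
  · obtain ⟨U₁, U₂, j₁, j₂, r₁, r₂, f₁, f₂, ⟨hU⟩⟩ := exists_decomposition (i₁ ≫ t)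
    have e' : i₁ ≫ s ≫ coprod.desc α α' = i₁ ≫ t ≫ coprod.desc α α' := by rw [e]
    apply cofan_ext hU
    · have := congr(j₁ ≫ $e')
      rw [reassoc_of% e₁] at this
      rw [e₁, f₁, ← Category.assoc]
      congr 1
      rw [← cancel_mono α]
      have h2 := reassoc_of% f₁
      rw [h2] at this
      simpa [coprod.inl_desc, coprod.inr_desc, coprod.inl_desc_assoc, coprod.inr_desc_assoc] using this
    · refine key _ _ (j₂ ≫ q₁) r₂ (by rw [e₁, Category.assoc]) f₂ ?_
      simp [e]
  · obtain ⟨U₁, U₂, j₁, j₂, r₁, r₂, f₁, f₂, ⟨hU⟩⟩ := exists_decomposition (i₂ ≫ t)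
    have e' : i₂ ≫ s ≫ coprod.desc α α' = i₂ ≫ t ≫ coprod.desc α α' := by rw [e]
    apply cofan_ext hU
    · refine (key _ _ r₁ (j₁ ≫ q₂) f₁ (by rw [e₂, Category.assoc]) ?_).symm
      simp [e]
    · have := congr(j₂ ≫ $e')
      rw [reassoc_of% e₂] at this
      rw [e₂, f₂, ← Category.assoc]
      congr 1
      rw [← cancel_mono α']
      have h2 := reassoc_of% f₂
      rw [h2] at this
      simpa [coprod.inl_desc, coprod.inr_desc, coprod.inl_desc_assoc, coprod.inr_desc_assoc] using this

lemma isComplement_iff {A A' B : C} {α : A ⟶ B} {α' : A' ⟶ B} :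
    IsComplement α α' ↔ Nonempty (IsColimit (BinaryCofan.mk α α')) := by
  constructor
  · rintro ⟨_, _, ⟨P, p, p', h, ⟨hP⟩⟩, hu⟩
    have := hu (coprod.desc α α') (mono_desc h hP) ⟨coprod.inl, coprod.inl_desc _ _⟩
      ⟨coprod.inr, coprod.inr_desc _ _⟩
    let e : A ⨿ A' ≅ B := asIso (coprod.desc α α')
    exact ⟨(coprodIsCoprod A A').ofIsoColimit (BinaryCofan.ext e
      (coprod.inl_desc α α') (coprod.inr_desc α α'))⟩
  · rintro ⟨h⟩
    refine ⟨FinitaryExtensive.mono_inl_of_isColimit h, FinitaryExtensive.mono_inr_of_isColimit h,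
      ⟨_, _, _, FinitaryExtensive.isPullback_initial_to_binaryCofan h, ⟨initialIsInitial⟩⟩, ?_⟩
    rintro S m hm ⟨s, hs⟩ ⟨s', hs'⟩
    obtain ⟨l, l₁, l₂⟩ := cofan_desc h s s'
    have hl : l ≫ m = 𝟙 B := cofan_ext h (by rw [reassoc_of% l₁, hs, Category.comp_id])
      (by rw [reassoc_of% l₂, hs', Category.comp_id])
    exact ⟨l, by rw [← cancel_mono m, Category.assoc, hl]; simp, hl⟩

lemma isComplemented_id (A : C) : IsComplemented (𝟙 A) :=
  ⟨⊥_ C, initial.to A, isComplement_iff.2 ⟨BinaryCofan.IsColimit.mk _ (fun f _ ↦ f)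
    (fun _ _ ↦ Category.id_comp _) (fun _ _ ↦ initialIsInitial.hom_ext _ _)
    (fun _ _ _ h _ ↦ (Category.id_comp _).symm.trans h)⟩⟩

lemma IsComplemented.comp {A B D : C} {α : A ⟶ B} {β : B ⟶ D} (hα : IsComplemented α)
    (hβ : IsComplemented β) : IsComplemented (α ≫ β) := by
  obtain ⟨A', α', h⟩ := hα
  obtain ⟨B', β', k⟩ := hβ
  obtain ⟨h⟩ := isComplement_iff.1 h
  obtain ⟨k⟩ := isComplement_iff.1 k
  refine ⟨A' ⨿ B', coprod.desc (α' ≫ β) β', isComplement_iff.2 ?_⟩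
  have key : ∀ {T : C} (f : A ⟶ T) (g : A' ⨿ B' ⟶ T), ∃ l : D ⟶ T, (α ≫ β) ≫ l = f ∧
      coprod.desc (α' ≫ β) β' ≫ l = g := by
    intro T f g
    obtain ⟨m, m₁, m₂⟩ := cofan_desc h f (coprod.inl ≫ g)
    obtain ⟨l, l₁, l₂⟩ := cofan_desc k m (coprod.inr ≫ g)
    refine ⟨l, by rw [Category.assoc, l₁, m₁], ?_⟩
    apply coprod.hom_ext
    · rw [coprod.inl_desc_assoc, Category.assoc, l₁, m₂]
    · rw [coprod.inr_desc_assoc, l₂]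
  choose l l₁ l₂ using @key
  refine ⟨BinaryCofan.IsColimit.mk _ (fun f g ↦ l f g) (fun f g ↦ l₁ f g) (fun f g ↦ l₂ f g) ?_⟩
  intro T f g m m₁ m₂
  apply cofan_ext k
  · apply cofan_ext h
    · have := m₁.trans (l₁ f g).symm
      exact (Category.assoc _ _ _).symm.trans (this.trans (Category.assoc _ _ _))
    · have e : coprod.desc (α' ≫ β) β' ≫ m = coprod.desc (α' ≫ β) β' ≫ l f g :=
        m₂.trans (l₂ f g).symm
      have e' := (coprod.inl_desc_assoc _ _ _).symm.trans
        (congr(coprod.inl ≫ $e).trans (coprod.inl_desc_assoc _ _ _))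
      exact (Category.assoc _ _ _).symm.trans (e'.trans (Category.assoc _ _ _))
  · have e : coprod.desc (α' ≫ β) β' ≫ m = coprod.desc (α' ≫ β) β' ≫ l f g :=
      m₂.trans (l₂ f g).symm
    exact (coprod.inr_desc_assoc _ _ _).symm.trans
      (congr(coprod.inr ≫ $e).trans (coprod.inr_desc_assoc _ _ _))

lemma IsComplemented.of_isPullback {P A B Y : C} {p : P ⟶ Y} {q : P ⟶ A} {f : Y ⟶ B} {α : A ⟶ B}
    (hα : IsComplemented α) (h : IsPullback p q f α) : IsComplemented p := by
  obtain ⟨A', α', k⟩ := hα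
  obtain ⟨k⟩ := isComplement_iff.1 k
  refine ⟨pullback f α', pullback.fst f α', isComplement_iff.2 ?_⟩
  exact ((BinaryCofan.isVanKampen_iff _).1 (FinitaryExtensive.vanKampen _ k)
    (BinaryCofan.mk p (pullback.fst f α')) q (pullback.snd f α') f h.w.symm
    pullback.condition.symm).2 ⟨h, IsPullback.of_hasPullback _ _⟩

end complements

section partialMaps

variable {C : Type u} [Category.{v} C]

/-- A representative of a partial map `A ⇀ B`: a complemented subobject `ι : dom ⟶ A` together with
a morphism `f : dom ⟶ B`. -/
structure PartialSpan (A B : C) where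
  dom : C
  ι : dom ⟶ A
  f : dom ⟶ B
  isComplemented : IsComplemented ι

/-- Two representatives define the same partial map when they differ by an isomorphism of domains,
i.e. by the choice of a representative of the subobject. -/
def PartialSpan.setoid (A B : C) : Setoid (PartialSpan A B) where
  r s t := ∃ e : s.dom ≅ t.dom, e.hom ≫ t.ι = s.ι ∧ e.hom ≫ t.f = s.f
  iseqv :=
    { refl s := ⟨Iso.refl _, by simp, by simp⟩
      symm := by
        rintro s t ⟨e, h₁, h₂⟩
        exact ⟨e.symm, by simp [← h₁], by simp [← h₂]⟩
      trans := by
        rintro s t w ⟨e, h₁, h₂⟩ ⟨e', h₃, h₄⟩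
        exact ⟨e ≪≫ e', by simp [h₁, h₃], by simp [h₂, h₄]⟩ }

variable (C) in
/-- The category of partial maps in `C`: same objects, and partial maps defined on complemented
subobjects. -/
structure PartialMaps where
  obj : C

variable [FinitaryExtensive C] [HasPullbacks C]

/-- Composition of partial maps, by pullback. -/
noncomputable def PartialSpan.comp {A B D : C} (s : PartialSpan A B) (t : PartialSpan B D) :
    PartialSpan A D where
  dom := pullback s.f t.ι
  ι := pullback.fst s.f t.ι ≫ s.ι
  f := pullback.snd s.f t.ι ≫ t.f
  isComplemented :=
    (t.isComplemented.of_isPullback (IsPullback.of_hasPullback s.f t.ι)).comp s.isComplemented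

/-- A morphism as an everywhere defined partial map. -/
def PartialSpan.ofHom {A B : C} (f : A ⟶ B) : PartialSpan A B where
  dom := A
  ι := 𝟙 A
  f := f
  isComplemented := isComplemented_id A

/-- The composite may be computed with any pullback. -/
lemma PartialSpan.comp_rel_of_isPullback {A B D : C} {s : PartialSpan A B} {t : PartialSpan B D}
    {w : PartialSpan A D} {p : w.dom ⟶ s.dom} {q : w.dom ⟶ t.dom}
    (h : IsPullback p q s.f t.ι) (h₁ : p ≫ s.ι = w.ι) (h₂ : q ≫ t.f = w.f) :
    PartialSpan.setoid A D (s.comp t) w := by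
  have k := IsPullback.of_hasPullback s.f t.ι
  refine ⟨k.isoIsPullback _ _ h, ?_, ?_⟩
  · rw [← h₁]; exact IsPullback.isoIsPullback_hom_fst_assoc _ _ k h _
  · rw [← h₂]; exact IsPullback.isoIsPullback_hom_snd_assoc _ _ k h _

lemma PartialSpan.comp_rel {A B D : C} {s s' : PartialSpan A B} {t t' : PartialSpan B D}
    (hs : PartialSpan.setoid A B s s') (ht : PartialSpan.setoid B D t t') :
    PartialSpan.setoid A D (s.comp t) (s'.comp t') := by
  obtain ⟨e, h₁, h₂⟩ := hs
  obtain ⟨e', h₃, h₄⟩ := ht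
  apply PartialSpan.comp_rel_of_isPullback (p := pullback.fst s'.f t'.ι ≫ e.inv)
    (q := pullback.snd s'.f t'.ι ≫ e'.inv)
  · exact IsPullback.of_iso (IsPullback.of_hasPullback s'.f t'.ι) (Iso.refl _) e.symm e'.symm
      (Iso.refl _) (Category.id_comp _).symm (Category.id_comp _).symm (by simp [← h₂])
      (by simp [← h₃])
  · simp [PartialSpan.comp, ← h₁]
  · simp [PartialSpan.comp, ← h₄]

/-- Partial maps, up to isomorphism of spans, form a category. -/
noncomputable instance : Category (PartialMaps C) where
  Hom A B := _root_.Quotient (PartialSpan.setoid A.obj B.obj)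
  id A := Quotient.mk _ (PartialSpan.ofHom (𝟙 A.obj))
  comp := Quotient.map₂ PartialSpan.comp fun _ _ hs _ _ ht ↦ PartialSpan.comp_rel hs ht
  id_comp := by
    rintro A B ⟨s⟩
    exact Quotient.sound (PartialSpan.comp_rel_of_isPullback (p := s.ι) (q := 𝟙 _)
      (isPullback_id_right s.ι) (Category.comp_id _)
      (Category.id_comp _))
  comp_id := by
    rintro A B ⟨s⟩
    exact Quotient.sound (PartialSpan.comp_rel_of_isPullback (p := 𝟙 _) (q := s.f)
      (isPullback_id_left _) (Category.id_comp _)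
      (Category.comp_id _))
  assoc := by
    rintro A B D E ⟨s⟩ ⟨t⟩ ⟨w⟩
    refine Quotient.sound ⟨pullbackAssoc s.f t.ι t.f w.ι, ?_, ?_⟩
    · simp [PartialSpan.comp]
    · simp [PartialSpan.comp]

namespace PartialMaps

/-- The partial map represented by a span. -/
def homMk {A B : C} (s : PartialSpan A B) : (⟨A⟩ : PartialMaps C) ⟶ ⟨B⟩ :=
  Quotient.mk (PartialSpan.setoid A B) s

lemma homMk_eq_iff {A B : C} {s t : PartialSpan A B} :
    homMk s = homMk t ↔ PartialSpan.setoid A B s t :=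
  ⟨fun h ↦ Quotient.exact h, fun h ↦ Quotient.sound h⟩

variable (C) in
/-- The functor sending a morphism to the partial map defined everywhere. -/
noncomputable def incl : C ⥤ PartialMaps C where
  obj A := ⟨A⟩
  map f := homMk (PartialSpan.ofHom f)
  map_id _ := rfl
  map_comp {A _ _} f g := (Quotient.sound (PartialSpan.comp_rel_of_isPullback
    (s := PartialSpan.ofHom f) (t := PartialSpan.ofHom g) (w := PartialSpan.ofHom (f ≫ g))
    (p := 𝟙 A) (q := f) (isPullback_id_left _)
    (Category.id_comp _) rfl)).symm

lemma eq_of_isInitial_dom {A B : C} {s t : PartialSpan A B} (hs : IsInitial s.dom)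
    (ht : IsInitial t.dom) : homMk s = homMk t :=
  homMk_eq_iff.2 ⟨hs.uniqueUpToIso ht, hs.hom_ext _ _, hs.hom_ext _ _⟩

/-- The initial object is a zero object for partial maps. -/
lemma isZero_incl {Z : C} (hZ : IsInitial Z) : IsZero ((incl C).obj Z) := by
  have hi : ∀ {D : C} (_ : D ⟶ Z), Nonempty (IsInitial D) := fun g ↦
    have := hZ.isIso_to g
    ⟨hZ.ofIso (asIso g).symm⟩
  constructor
  · rintro ⟨B⟩
    refine ⟨⟨⟨homMk (PartialSpan.ofHom (hZ.to B))⟩, ?_⟩⟩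
    rintro ⟨s⟩
    exact eq_of_isInitial_dom (hi s.ι).some (hi (𝟙 Z)).some
  · rintro ⟨B⟩
    have hc : IsComplemented (hZ.to B) := by
      refine ⟨B, 𝟙 B, isComplement_iff.2 ⟨BinaryCofan.IsColimit.mk _ (fun _ g ↦ g)
        (fun _ _ ↦ hZ.hom_ext _ _) (fun _ _ ↦ Category.id_comp _)
        (fun _ _ _ _ h ↦ (Category.id_comp _).symm.trans h)⟩⟩
    refine ⟨⟨⟨homMk ⟨Z, hZ.to B, 𝟙 Z, hc⟩⟩, ?_⟩⟩
    rintro ⟨s⟩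
    exact eq_of_isInitial_dom (hi s.f).some hZ

end PartialMaps
end partialMaps

/-- An internal preorder `(X, R)` in `C`: a relation on `X`, given by a jointly monic pair
`r₁, r₂ : R ⟶ X`, which is reflexive and transitive (joint monicity is part of
`ReflexiveRelation` and `TransitiveRelation`). -/
structure PreOrd (C : Type u) [Category.{v} C] where
  X : C
  R : C
  r₁ : R ⟶ X
  r₂ : R ⟶ X
  refl : Nonempty (ReflexiveRelation r₁ r₂)
  trans : Nonempty (TransitiveRelation r₁ r₂)

namespace PreOrd

variable {C : Type u} [Category.{v} C]

/-- A morphism of preorders is a pair `(f, fhat)` compatible with both projections. -/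
@[ext]
structure Hom (A B : PreOrd C) where
  f : A.X ⟶ B.X
  fhat : A.R ⟶ B.R
  comm₁ : A.r₁ ≫ f = fhat ≫ B.r₁
  comm₂ : A.r₂ ≫ f = fhat ≫ B.r₂


instance : Category (PreOrd C) where
  Hom := Hom
  id A := { f := 𝟙 A.X, fhat := 𝟙 A.R, comm₁ := by simp, comm₂ := by simp }
  comp g h :=
    { f := g.f ≫ h.f
      fhat := g.fhat ≫ h.fhat
      comm₁ := by rw [← Category.assoc, g.comm₁, Category.assoc, h.comm₁, Category.assoc]
      comm₂ := by rw [← Category.assoc, g.comm₂, Category.assoc, h.comm₂, Category.assoc] }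

@[simp] lemma id_f (A : PreOrd C) : (𝟙 A : A ⟶ A).f = 𝟙 A.X := rfl
@[simp] lemma id_fhat (A : PreOrd C) : (𝟙 A : A ⟶ A).fhat = 𝟙 A.R := rfl
@[simp] lemma comp_f {A B D : PreOrd C} (g : A ⟶ B) (h : B ⟶ D) : (g ≫ h).f = g.f ≫ h.f := rfl
@[simp] lemma comp_fhat {A B D : PreOrd C} (g : A ⟶ B) (h : B ⟶ D) :
    (g ≫ h).fhat = g.fhat ≫ h.fhat := rfl

lemma rel_ext (A : PreOrd C) {T : C} {s t : T ⟶ A.R} (h₁ : s ≫ A.r₁ = t ≫ A.r₁)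
    (h₂ : s ≫ A.r₂ = t ≫ A.r₂) : s = t :=
  A.refl.some.toJointlyMono₂.right_cancellation s t h₁ h₂

lemma comm1 {A B : PreOrd C} (g : A ⟶ B) : A.r₁ ≫ g.f = g.fhat ≫ B.r₁ := g.comm₁
lemma comm2 {A B : PreOrd C} (g : A ⟶ B) : A.r₂ ≫ g.f = g.fhat ≫ B.r₂ := g.comm₂

lemma hom_ext {A B : PreOrd C} {g h : A ⟶ B} (e : g.f = h.f) : g = h := by
  refine Hom.ext e (B.rel_ext ?_ ?_)
  · rw [← comm1, ← comm1, e]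
  · rw [← comm2, ← comm2, e]

lemma trans_elt (A : PreOrd C) {T : C} (s t : T ⟶ A.R) (h : s ≫ A.r₂ = t ≫ A.r₁) :
    ∃ w : T ⟶ A.R, w ≫ A.r₁ = s ≫ A.r₁ ∧ w ≫ A.r₂ = t ≫ A.r₂ := by
  obtain ⟨τ⟩ := A.trans
  let l : T ⟶ τ.c.pt := PullbackCone.IsLimit.lift τ.isLimit s t h
  have h₁ : l ≫ τ.c.fst = s := PullbackCone.IsLimit.lift_fst _ _ _ _
  have h₂ : l ≫ τ.c.snd = t := PullbackCone.IsLimit.lift_snd _ _ _ _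
  refine ⟨l ≫ τ.t, ?_, ?_⟩
  · rw [Category.assoc, τ.transitivity₁, reassoc_of% h₁]
  · rw [Category.assoc, τ.transitivity₂, reassoc_of% h₂]

/-- Build a preorder from reflexivity and transitivity stated on generalized elements. -/
def ofElements [HasPullbacks C] {X R : C} (r₁ r₂ : R ⟶ X)
    (hm : ∀ ⦃T : C⦄ (s t : T ⟶ R), s ≫ r₁ = t ≫ r₁ → s ≫ r₂ = t ≫ r₂ → s = t)
    (hr : ∃ r : X ⟶ R, r ≫ r₁ = 𝟙 X ∧ r ≫ r₂ = 𝟙 X)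
    (ht : ∀ ⦃T : C⦄ (s t : T ⟶ R), s ≫ r₂ = t ≫ r₁ →
      ∃ w : T ⟶ R, w ≫ r₁ = s ≫ r₁ ∧ w ≫ r₂ = t ≫ r₂) : PreOrd C where
  X := X
  R := R
  r₁ := r₁
  r₂ := r₂
  refl := by
    obtain ⟨r, h₁, h₂⟩ := hr
    exact ⟨{ right_cancellation := hm, r := r, reflexivity₁ := h₁, reflexivity₂ := h₂ }⟩
  trans := by
    obtain ⟨w, h₁, h₂⟩ := ht (pullback.fst r₂ r₁) (pullback.snd r₂ r₁) pullback.condition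
    exact ⟨{ right_cancellation := hm
             c := PullbackCone.mk (pullback.fst r₂ r₁) (pullback.snd r₂ r₁) pullback.condition
             isLimit := pullbackIsPullback r₂ r₁
             t := w
             transitivity₁ := h₁
             transitivity₂ := h₂ }⟩

/-- A square of preorders which is a pullback on underlying objects and on relations is a
pullback. -/
lemma isPullback_of {P A B D : PreOrd C} {p : P ⟶ A} {q : P ⟶ B} {g : A ⟶ D} {h : B ⟶ D}
    (h₁ : IsPullback p.f q.f g.f h.f) (h₂ : IsPullback p.fhat q.fhat g.fhat h.fhat) :
    IsPullback p q g h := by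
  refine ⟨⟨hom_ext h₁.w⟩, ⟨PullbackCone.IsLimit.mk _ (fun s ↦
    { f := h₁.lift s.fst.f s.snd.f congr(($(s.condition)).f)
      fhat := h₂.lift s.fst.fhat s.snd.fhat congr(($(s.condition)).fhat)
      comm₁ := ?_
      comm₂ := ?_ }) ?_ ?_ ?_⟩⟩
  · apply h₁.hom_ext
    · rw [Category.assoc, Category.assoc, h₁.lift_fst, comm1 p, h₂.lift_fst_assoc]
      exact comm1 s.fst
    · rw [Category.assoc, Category.assoc, h₁.lift_snd, comm1 q, h₂.lift_snd_assoc]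
      exact comm1 s.snd
  · apply h₁.hom_ext
    · rw [Category.assoc, Category.assoc, h₁.lift_fst, comm2 p, h₂.lift_fst_assoc]
      exact comm2 s.fst
    · rw [Category.assoc, Category.assoc, h₁.lift_snd, comm2 q, h₂.lift_snd_assoc]
      exact comm2 s.snd
  · intro s; apply hom_ext; simp
  · intro s; apply hom_ext; simp
  · intro s m e₁ e₂
    apply hom_ext
    apply h₁.hom_ext
    · simpa using congr(($e₁).f)
    · simpa using congr(($e₂).f)

/-- Preorders have pullbacks, computed on underlying objects and on relations. -/
lemma exists_isPullback [HasPullbacks C] {A B D : PreOrd C} (g : A ⟶ D) (h : B ⟶ D) :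
    ∃ (P : PreOrd C) (p : P ⟶ A) (q : P ⟶ B),
      IsPullback p.f q.f g.f h.f ∧ IsPullback p.fhat q.fhat g.fhat h.fhat := by
  have hX := IsPullback.of_hasPullback g.f h.f
  have hR := IsPullback.of_hasPullback g.fhat h.fhat
  generalize pullback.fst g.f h.f = p at hX
  generalize pullback.snd g.f h.f = q at hX
  generalize pullback.fst g.fhat h.fhat = p' at hR
  generalize pullback.snd g.fhat h.fhat = q' at hR
  obtain ⟨s₁, a₁, b₁⟩ : ∃ s, s ≫ p = p' ≫ A.r₁ ∧ s ≫ q = q' ≫ B.r₁ :=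
    ⟨hX.lift (p' ≫ A.r₁) (q' ≫ B.r₁) (by
      rw [Category.assoc, Category.assoc, comm1, comm1, hR.w_assoc]),
      hX.lift_fst _ _ _, hX.lift_snd _ _ _⟩
  obtain ⟨s₂, a₂, b₂⟩ : ∃ s, s ≫ p = p' ≫ A.r₂ ∧ s ≫ q = q' ≫ B.r₂ :=
    ⟨hX.lift (p' ≫ A.r₂) (q' ≫ B.r₂) (by
      rw [Category.assoc, Category.assoc, comm2, comm2, hR.w_assoc]),
      hX.lift_fst _ _ _, hX.lift_snd _ _ _⟩
  have key : ∀ {T : C} (u : T ⟶ A.R) (w : T ⟶ B.R), u ≫ A.r₁ ≫ g.f = w ≫ B.r₁ ≫ h.f →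
      u ≫ A.r₂ ≫ g.f = w ≫ B.r₂ ≫ h.f → ∃ t, t ≫ p' = u ∧ t ≫ q' = w := by
    intro T u w e₁ e₂
    refine ⟨hR.lift u w ?_, hR.lift_fst _ _ _, hR.lift_snd _ _ _⟩
    apply D.rel_ext
    · rw [Category.assoc, Category.assoc, ← comm1, ← comm1, e₁]
    · rw [Category.assoc, Category.assoc, ← comm2, ← comm2, e₂]
  refine ⟨ofElements s₁ s₂ ?_ ?_ ?_, ⟨p, p', a₁, a₂⟩, ⟨q, q', b₁, b₂⟩, hX, hR⟩
  · intro T s t h₁ h₂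
    apply hR.hom_ext
    · apply A.rel_ext
      · rw [Category.assoc, Category.assoc, ← a₁, reassoc_of% h₁]
      · rw [Category.assoc, Category.assoc, ← a₂, reassoc_of% h₂]
    · apply B.rel_ext
      · rw [Category.assoc, Category.assoc, ← b₁, reassoc_of% h₁]
      · rw [Category.assoc, Category.assoc, ← b₂, reassoc_of% h₂]
  · obtain ⟨a⟩ := A.refl
    obtain ⟨b⟩ := B.refl
    obtain ⟨t, t₁, t₂⟩ := key (p ≫ a.r) (q ≫ b.r)
      (by simp [hX.w]) (by simp [hX.w])
    refine ⟨t, hX.hom_ext ?_ ?_, hX.hom_ext ?_ ?_⟩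
    · rw [Category.assoc, a₁, reassoc_of% t₁]; simp
    · rw [Category.assoc, b₁, reassoc_of% t₂]; simp
    · rw [Category.assoc, a₂, reassoc_of% t₁]; simp
    · rw [Category.assoc, b₂, reassoc_of% t₂]; simp
  · intro T s t e
    obtain ⟨u, u₁, u₂⟩ := A.trans_elt (s ≫ p') (t ≫ p')
      (by rw [Category.assoc, Category.assoc, ← a₁, ← a₂, reassoc_of% e])
    obtain ⟨w, w₁, w₂⟩ := B.trans_elt (s ≫ q') (t ≫ q')
      (by rw [Category.assoc, Category.assoc, ← b₁, ← b₂, reassoc_of% e])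
    obtain ⟨x, x₁, x₂⟩ := key u w
      (by rw [reassoc_of% u₁, reassoc_of% w₁, comm1, comm1, hR.w_assoc])
      (by rw [reassoc_of% u₂, reassoc_of% w₂, comm2, comm2, hR.w_assoc])
    refine ⟨x, hX.hom_ext ?_ ?_, hX.hom_ext ?_ ?_⟩
    · rw [Category.assoc, Category.assoc, a₁, reassoc_of% x₁, u₁, Category.assoc]
    · rw [Category.assoc, Category.assoc, b₁, reassoc_of% x₂, w₁, Category.assoc]
    · rw [Category.assoc, Category.assoc, a₂, reassoc_of% x₁, u₂, Category.assoc]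
    · rw [Category.assoc, Category.assoc, b₂, reassoc_of% x₂, w₂, Category.assoc]

instance [HasPullbacks C] : HasPullbacks (PreOrd C) := by
  have : ∀ {A B D : PreOrd C} {g : A ⟶ D} {h : B ⟶ D}, HasLimit (cospan g h) := by
    intro A B D g h
    obtain ⟨P, p, q, h₁, h₂⟩ := exists_isPullback g h
    exact (isPullback_of h₁ h₂).hasPullback
  exact hasPullbacks_of_hasLimit_cospan _

/-- The underlying object functor. -/
def forget (C : Type u) [Category.{v} C] : PreOrd C ⥤ C where
  obj A := A.X
  map g := g.f

/-- The relation functor. -/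
def relFunctor (C : Type u) [Category.{v} C] : PreOrd C ⥤ C where
  obj A := A.R
  map g := g.fhat

lemma isPullback_iff [HasPullbacks C] {P A B D : PreOrd C} {p : P ⟶ A} {q : P ⟶ B} {g : A ⟶ D}
    {h : B ⟶ D} : IsPullback p q g h ↔
      IsPullback p.f q.f g.f h.f ∧ IsPullback p.fhat q.fhat g.fhat h.fhat := by
  refine ⟨fun H ↦ ?_, fun H ↦ isPullback_of H.1 H.2⟩
  obtain ⟨P', p', q', h₁, h₂⟩ := exists_isPullback g h
  have H' := isPullback_of h₁ h₂
  let e := H.isoIsPullback _ _ H'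
  have e₁ : e.inv ≫ p = p' := H.isoIsPullback_inv_fst _ _ H'
  have e₂ : e.inv ≫ q = q' := H.isoIsPullback_inv_snd _ _ H'
  exact ⟨IsPullback.of_iso h₁ ((forget C).mapIso e.symm)
      (Iso.refl _) (Iso.refl _) (Iso.refl _) ((Category.comp_id _).trans congr(($e₁).f).symm)
      ((Category.comp_id _).trans congr(($e₂).f).symm) (by simp) (by simp),
    IsPullback.of_iso h₂ ((relFunctor C).mapIso e.symm)
      (Iso.refl _) (Iso.refl _) (Iso.refl _) ((Category.comp_id _).trans congr(($e₁).fhat).symm)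
      ((Category.comp_id _).trans congr(($e₂).fhat).symm) (by simp) (by simp)⟩

lemma isColimit_of {A B S : PreOrd C} {i : A ⟶ S} {j : B ⟶ S}
    (h₁ : IsColimit (BinaryCofan.mk i.f j.f)) (h₂ : IsColimit (BinaryCofan.mk i.fhat j.fhat)) :
    Nonempty (IsColimit (BinaryCofan.mk i j)) := by
  have key : ∀ (T : PreOrd C) (g : A ⟶ T) (h : B ⟶ T), ∃ l : S ⟶ T, i ≫ l = g ∧ j ≫ l = h := by
    intro T g h
    obtain ⟨l, l₁, l₂⟩ := cofan_desc h₁ g.f h.f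
    obtain ⟨m, m₁, m₂⟩ := cofan_desc h₂ g.fhat h.fhat
    refine ⟨⟨l, m, cofan_ext h₂ ?_ ?_, cofan_ext h₂ ?_ ?_⟩, hom_ext l₁, hom_ext l₂⟩
    · rw [reassoc_of% m₁, ← comm1 g, ← l₁, ← Category.assoc, ← Category.assoc, ← comm1]
    · rw [reassoc_of% m₂, ← comm1 h, ← l₂, ← Category.assoc, ← Category.assoc, ← comm1]
    · rw [reassoc_of% m₁, ← comm2 g, ← l₁, ← Category.assoc, ← Category.assoc, ← comm2]
    · rw [reassoc_of% m₂, ← comm2 h, ← l₂, ← Category.assoc, ← Category.assoc, ← comm2]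
  choose l l₁ l₂ using key
  refine ⟨BinaryCofan.IsColimit.mk _ (fun {T} g h ↦ l T g h) (fun g h ↦ l₁ _ g h)
    (fun g h ↦ l₂ _ g h) ?_⟩
  intro T g h m m₁ m₂
  apply hom_ext
  apply cofan_ext h₁
  · exact congr(($(m₁.trans (l₁ _ g h).symm)).f)
  · exact congr(($(m₂.trans (l₂ _ g h).symm)).f)

section extensive

variable [FinitaryExtensive C]

/-- The coproduct of preorders, computed on underlying objects and on relations. -/
noncomputable def sum [HasPullbacks C] (A B : PreOrd C) : PreOrd C :=
  ofElements (coprod.map A.r₁ B.r₁) (coprod.map A.r₂ B.r₂)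
    (by
      intro T s t h₁ h₂
      obtain ⟨T₁, T₂, i₁, i₂, q₁, q₂, e₁, e₂, ⟨hT⟩⟩ :=
        exists_decomposition (s ≫ coprod.map A.r₁ B.r₁)
      have hl := (isPullback_coprod_map A.r₁ B.r₁).1
      have hr := (isPullback_coprod_map A.r₁ B.r₁).2
      apply cofan_ext hT
      · obtain ⟨s₁, a₁, a₂⟩ := hl.exists_lift (i₁ ≫ s) q₁ (by rw [Category.assoc, e₁])
        obtain ⟨t₁, b₁, b₂⟩ := hl.exists_lift (i₁ ≫ t) q₁ (by rw [Category.assoc, ← h₁, e₁])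
        rw [← a₁, ← b₁]
        congr 1
        apply A.rel_ext (a₂.trans b₂.symm)
        rw [← cancel_mono (coprod.inl : A.X ⟶ A.X ⨿ B.X)]
        have := congr(i₁ ≫ $h₂)
        rw [← reassoc_of% a₁, ← reassoc_of% b₁] at this
        simpa using this
      · obtain ⟨s₁, a₁, a₂⟩ := hr.exists_lift (i₂ ≫ s) q₂ (by rw [Category.assoc, e₂])
        obtain ⟨t₁, b₁, b₂⟩ := hr.exists_lift (i₂ ≫ t) q₂ (by rw [Category.assoc, ← h₁, e₂])
        rw [← a₁, ← b₁]
        congr 1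
        apply B.rel_ext (a₂.trans b₂.symm)
        rw [← cancel_mono (coprod.inr : B.X ⟶ A.X ⨿ B.X)]
        have := congr(i₂ ≫ $h₂)
        rw [← reassoc_of% a₁, ← reassoc_of% b₁] at this
        simpa using this)
    (by
      obtain ⟨a⟩ := A.refl
      obtain ⟨b⟩ := B.refl
      exact ⟨coprod.map a.r b.r, by simp, by simp⟩)
    (by
      intro T s t h
      obtain ⟨T₁, T₂, i₁, i₂, q₁, q₂, e₁, e₂, ⟨hT⟩⟩ :=
        exists_decomposition (s ≫ coprod.map A.r₂ B.r₂)
      obtain ⟨s₁, a₁, a₂⟩ := (isPullback_coprod_map A.r₂ B.r₂).1.exists_lift (i₁ ≫ s) q₁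
        (by rw [Category.assoc, e₁])
      obtain ⟨t₁, b₁, b₂⟩ := (isPullback_coprod_map A.r₁ B.r₁).1.exists_lift (i₁ ≫ t) q₁
        (by rw [Category.assoc, ← h, e₁])
      obtain ⟨s₂, c₁, c₂⟩ := (isPullback_coprod_map A.r₂ B.r₂).2.exists_lift (i₂ ≫ s) q₂
        (by rw [Category.assoc, e₂])
      obtain ⟨t₂, d₁, d₂⟩ := (isPullback_coprod_map A.r₁ B.r₁).2.exists_lift (i₂ ≫ t) q₂
        (by rw [Category.assoc, ← h, e₂])
      obtain ⟨w₁, x₁, y₁⟩ := A.trans_elt s₁ t₁ (a₂.trans b₂.symm)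
      obtain ⟨w₂, x₂, y₂⟩ := B.trans_elt s₂ t₂ (c₂.trans d₂.symm)
      obtain ⟨w, z₁, z₂⟩ := cofan_desc hT (w₁ ≫ coprod.inl) (w₂ ≫ coprod.inr)
      refine ⟨w, cofan_ext hT ?_ ?_, cofan_ext hT ?_ ?_⟩
      · rw [reassoc_of% z₁, ← reassoc_of% a₁, coprod.inl_map, reassoc_of% x₁]
      · rw [reassoc_of% z₂, ← reassoc_of% c₁, coprod.inr_map, reassoc_of% x₂]
      · rw [reassoc_of% z₁, ← reassoc_of% b₁, coprod.inl_map, reassoc_of% y₁]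
      · rw [reassoc_of% z₂, ← reassoc_of% d₁, coprod.inr_map, reassoc_of% y₂])

section

variable [HasPullbacks C] (A B : PreOrd C)

/-- First coprojection. -/
noncomputable def sumInl : A ⟶ sum A B where
  f := coprod.inl
  fhat := coprod.inl
  comm₁ := (coprod.inl_map A.r₁ B.r₁).symm
  comm₂ := (coprod.inl_map A.r₂ B.r₂).symm

/-- Second coprojection. -/
noncomputable def sumInr : B ⟶ sum A B where
  f := coprod.inr
  fhat := coprod.inr
  comm₁ := (coprod.inr_map A.r₁ B.r₁).symm
  comm₂ := (coprod.inr_map A.r₂ B.r₂).symm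

lemma sum_isColimit : Nonempty (IsColimit (BinaryCofan.mk (sumInl A B) (sumInr A B))) :=
  isColimit_of (coprodIsCoprod A.X B.X) (coprodIsCoprod A.R B.R)

instance : HasBinaryCoproducts (PreOrd C) := by
  have : ∀ {X Y : PreOrd C}, HasColimit (pair X Y) :=
    fun {X Y} ↦ ⟨⟨⟨BinaryCofan.mk (sumInl X Y) (sumInr X Y), (sum_isColimit X Y).some⟩⟩⟩
  exact hasBinaryCoproducts_of_hasColimit_pair _

/-- The initial object of `C` with its only preorder. -/
noncomputable def empty (C : Type u) [Category.{v} C] [FinitaryExtensive C] [HasPullbacks C] :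
    PreOrd C :=
  ofElements (𝟙 (⊥_ C)) (𝟙 (⊥_ C)) (fun T s t h _ ↦ by simpa using h)
    ⟨𝟙 _, by simp, by simp⟩ (fun T s t h ↦ ⟨s, rfl, h⟩)

/-- `empty` is initial. -/
noncomputable def emptyIsInitial (C : Type u) [Category.{v} C] [FinitaryExtensive C]
    [HasPullbacks C] : IsInitial (empty C) :=
  IsInitial.ofUniqueHom
    (fun A ↦ { f := initial.to _, fhat := initial.to _, comm₁ := initialIsInitial.hom_ext _ _,
               comm₂ := initialIsInitial.hom_ext _ _ })
    (fun _ _ ↦ hom_ext (initialIsInitial.hom_ext _ _))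

instance : HasInitial (PreOrd C) := (emptyIsInitial C).hasInitial

instance : HasFiniteCoproducts (PreOrd C) := hasFiniteCoproducts_of_has_binary_and_initial

variable {A B}

lemma isColimit_iff {S : PreOrd C} {i : A ⟶ S} {j : B ⟶ S} :
    Nonempty (IsColimit (BinaryCofan.mk i j)) ↔
      Nonempty (IsColimit (BinaryCofan.mk i.f j.f)) ∧
      Nonempty (IsColimit (BinaryCofan.mk i.fhat j.fhat)) := by
  refine ⟨fun ⟨H⟩ ↦ ?_, fun ⟨⟨h₁⟩, ⟨h₂⟩⟩ ↦ isColimit_of h₁ h₂⟩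
  obtain ⟨H'⟩ := sum_isColimit A B
  let e : sum A B ≅ S := H'.coconePointUniqueUpToIso H
  have e₁ : sumInl A B ≫ e.hom = i :=
    H'.comp_coconePointUniqueUpToIso_hom H ⟨WalkingPair.left⟩
  have e₂ : sumInr A B ≫ e.hom = j :=
    H'.comp_coconePointUniqueUpToIso_hom H ⟨WalkingPair.right⟩
  refine ⟨⟨IsColimit.ofIsoColimit (coprodIsCoprod A.X B.X)
    (BinaryCofan.ext ((forget C).mapIso e) ?_ ?_)⟩,
    ⟨IsColimit.ofIsoColimit (coprodIsCoprod A.R B.R)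
    (BinaryCofan.ext ((relFunctor C).mapIso e) ?_ ?_)⟩⟩
  · exact congr(($e₁).f)
  · exact congr(($e₂).f)
  · exact congr(($e₁).fhat)
  · exact congr(($e₂).fhat)

instance : FinitaryExtensive (PreOrd C) where
  van_kampen' {_ _} c hc := by
    obtain ⟨h₁, h₂⟩ := isColimit_iff.1
      ⟨hc.ofIsoColimit (show c ≅ BinaryCofan.mk c.inl c.inr from isoBinaryCofanMk c)⟩
    rw [BinaryCofan.isVanKampen_iff]
    intro A' B' c' a b g ha hb
    have k₁ := (BinaryCofan.isVanKampen_iff _).1 (FinitaryExtensive.vanKampen _ h₁.some)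
      (BinaryCofan.mk c'.inl.f c'.inr.f) a.f b.f g.f congr(($ha).f) congr(($hb).f)
    have k₂ := (BinaryCofan.isVanKampen_iff _).1 (FinitaryExtensive.vanKampen _ h₂.some)
      (BinaryCofan.mk c'.inl.fhat c'.inr.fhat) a.fhat b.fhat g.fhat congr(($ha).fhat)
      congr(($hb).fhat)
    have k : Nonempty (IsColimit c') ↔ Nonempty (IsColimit (BinaryCofan.mk c'.inl c'.inr)) :=
      ⟨fun ⟨h⟩ ↦ ⟨h.ofIsoColimit (isoBinaryCofanMk c')⟩,
        fun ⟨h⟩ ↦ ⟨h.ofIsoColimit (isoBinaryCofanMk c').symm⟩⟩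
    exact (k.trans isColimit_iff).trans (((and_congr k₁ k₂).trans and_and_and_comm).trans
      (and_congr isPullback_iff isPullback_iff).symm)

end

end extensive

end PreOrd

namespace PreOrd

variable {C : Type u} [Category.{v} C]

/-- A preorder which is an equivalence relation. -/
def IsEquivalence (A : PreOrd C) : Prop := Nonempty (SymmetricRelation A.r₁ A.r₂)

/-- A preorder which is antisymmetric: `R ∩ Rᵒ` is the discrete relation. A generalized element of
`R ∩ Rᵒ` is a pair `s, t` of generalized elements of `R` with `t` the reverse of `s`. -/
def IsPartialOrder (A : PreOrd C) : Prop :=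
  ∀ ⦃T : C⦄ (s t : T ⟶ A.R), s ≫ A.r₁ = t ≫ A.r₂ → s ≫ A.r₂ = t ≫ A.r₁ → s ≫ A.r₁ = s ≫ A.r₂

/-- Trivial objects: both an equivalence relation and a partial order. -/
def IsTrivialObj (A : PreOrd C) : Prop := A.IsEquivalence ∧ A.IsPartialOrder

/-- The trivial objects are the discrete preorders. -/
lemma isTrivialObj_iff (A : PreOrd C) : A.IsTrivialObj ↔ A.r₁ = A.r₂ := by
  constructor
  · rintro ⟨⟨σ⟩, h⟩
    simpa using h (𝟙 _) σ.s (by simp) (by simp)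
  · intro h
    refine ⟨⟨{ toJointlyMono₂ := A.refl.some.toJointlyMono₂
               s := 𝟙 _
               symmetry₁ := by simp [h]
               symmetry₂ := by simp [h] }⟩, fun T s t _ _ ↦ by rw [h]⟩

/-- A trivial morphism: one that factors through a trivial object. -/
def IsTrivial {A B : PreOrd C} (f : A ⟶ B) : Prop :=
  ∃ (Z : PreOrd C) (g : A ⟶ Z) (h : Z ⟶ B), Z.IsTrivialObj ∧ g ≫ h = f

/-- `k` is a kernel of `f` relative to the ideal of trivial morphisms. -/
structure IsZKernel {K A B : PreOrd C} (k : K ⟶ A) (f : A ⟶ B) : Prop where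
  isTrivial_comp : IsTrivial (k ≫ f)
  existsUnique_lift : ∀ ⦃Y : PreOrd C⦄ (l : Y ⟶ A), IsTrivial (l ≫ f) → ∃! l' : Y ⟶ K, l' ≫ k = l

/-- A congruence diagram between two representatives `s, t` of partial maps `A ⇀ B`: a complemented
subobject `A₀` of `A`, contained in both domains as a complemented subobject, on which `s` and `t`
agree, and such that `s` and `t` are trivial on the complements of `A₀` in their domains. -/
structure CongruenceDiagram {A B : PreOrd C} (s t : PartialSpan A B) where
  A₀ : PreOrd C
  α₀ : A₀ ⟶ A
  α₁ : A₀ ⟶ s.dom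
  α₂ : A₀ ⟶ t.dom
  complemented : IsComplemented α₀
  w₁ : α₁ ≫ s.ι = α₀
  w₂ : α₂ ≫ t.ι = α₀
  C₁ : PreOrd C
  C₂ : PreOrd C
  γ₁ : C₁ ⟶ s.dom
  γ₂ : C₂ ⟶ t.dom
  isComplement₁ : IsComplement α₁ γ₁
  isComplement₂ : IsComplement α₂ γ₂
  agree : α₁ ≫ s.f = α₂ ≫ t.f
  isTrivial₁ : IsTrivial (γ₁ ≫ s.f)
  isTrivial₂ : IsTrivial (γ₂ ≫ t.f)

end PreOrd

section stab

variable (C : Type u) [Category.{v} C] [FinitaryExtensive C] [HasPullbacks C]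

/-- The category of partial morphisms of internal preorders. -/
abbrev PaPreOrd := PartialMaps (PreOrd C)

/-- Two parallel partial morphisms are equivalent if there is a congruence diagram between them. -/
def congruenceRel : HomRel (PaPreOrd C) := fun A B p q ↦
  ∃ s t : PartialSpan A.obj B.obj, PartialMaps.homMk s = p ∧ PartialMaps.homMk t = q ∧
    Nonempty (PreOrd.CongruenceDiagram s t)

/-- The stable category: the quotient of the category of partial morphisms by `congruenceRel`. -/
abbrev Stab := CategoryTheory.Quotient (congruenceRel C)

namespace Stab

/-- The canonical functor from preorders to the stable category. -/
noncomputable def sigma : PreOrd C ⥤ Stab C :=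
  PartialMaps.incl (PreOrd C) ⋙ CategoryTheory.Quotient.functor (congruenceRel C)

variable {C} in
/-- The morphism `⟨α, f⟩` of the stable category. -/
noncomputable def homMk {A A' B : PreOrd C} (α : A' ⟶ A) (f : A' ⟶ B) (hα : IsComplemented α) :
    (sigma C).obj A ⟶ (sigma C).obj B :=
  (CategoryTheory.Quotient.functor (congruenceRel C)).map
    (PartialMaps.homMk { dom := A', ι := α, f := f, isComplemented := hα })

/-- The stable category is pointed: the image of the initial preorder is a zero object. -/
lemma isZero_sigma_initial : IsZero ((sigma C).obj (⊥_ (PreOrd C))) := by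
  have h := PartialMaps.isZero_incl (initialIsInitial (C := PreOrd C))
  constructor
  · rintro ⟨B⟩
    obtain ⟨u⟩ := h.unique_to B
    refine ⟨⟨⟨(CategoryTheory.Quotient.functor _).map u.default⟩, ?_⟩⟩
    rintro ⟨s⟩
    exact congr((CategoryTheory.Quotient.functor (congruenceRel C)).map $(u.uniq s))
  · rintro ⟨B⟩
    obtain ⟨u⟩ := h.unique_from B
    refine ⟨⟨⟨(CategoryTheory.Quotient.functor _).map u.default⟩, ?_⟩⟩
    rintro ⟨s⟩
    exact congr((CategoryTheory.Quotient.functor (congruenceRel C)).map $(u.uniq s))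

/-- The zero morphisms are the morphisms factoring through the zero object. -/
noncomputable instance : HasZeroMorphisms (Stab C) := (isZero_sigma_initial C).hasZeroMorphisms

instance : HasZeroObject (Stab C) := ⟨⟨_, isZero_sigma_initial C⟩⟩

end Stab

end stab

end StableCat

open StableCat

/-!
The kernel of `⟨α, f⟩` keeps the complement of the domain of `f` untouched, and shrinks the relation
on that domain to the pairs identified by `f`.

A morphism of preorders is trivial exactly when it equalizes the two projections of the relation of
its domain (`PreOrd.isTrivial_iff`). Hence the kernel of `f` relative to trivial morphisms exists,
and it is invertible on underlying objects: it only restricts the relation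
(`PreOrd.exists_isZKernel`, `PreOrd.IsZKernel.isIso_f`). By the same criterion, triviality may be tested on
complementary summands, and can be cancelled along maps that are monic on underlying objects.

The stable category is a quotient by a generated congruence, so equality in it has to be made
explicit. Congruence diagrams can be composed, and pulled back along partial maps on either side, so
`congruenceRel` is already a congruence; two spans agree in the stable category exactly when there is
a congruence diagram between them (`Stab.homMk_eq_iff`). In particular `⟨α, f⟩ = 0` if and only if
`f` is trivial (`Stab.homMk_eq_zero_iff`), and a morphism which is monic on underlying objects stays
monic in the stable category (`Stab.mono_sigma_map`).

The last fact gives uniqueness of factorizations through `K ⨿ A'c ⟶ A`. Existence follows by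
extensivity: the domain of a partial map into `A` splits into the preimages of `A'` and of `A'c`, and
on the first one the universal property of `K` applies.
-/

namespace StableCat

/-! ### Complemented subobjects in an extensive category -/

section complements

variable {C : Type u} [Category.{v} C]

/-- The complement of an initial subobject is everything. -/
lemma IsComplement.isIso_of_isInitial {A A' B : C} {α : A ⟶ B} {α' : A' ⟶ B}
    (h : IsComplement α α') (hA : IsInitial A) : IsIso α' :=
  h.union α' h.mono_right ⟨hA.to A', hA.hom_ext _ _⟩ ⟨𝟙 _, Category.id_comp _⟩

variable [FinitaryExtensive C] [HasPullbacks C]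

lemma IsComplement.symm {A A' B : C} {α : A ⟶ B} {α' : A' ⟶ B} (h : IsComplement α α') :
    IsComplement α' α := by
  obtain ⟨k⟩ := isComplement_iff.1 h
  exact isComplement_iff.2 ⟨BinaryCofan.isColimitFlip k⟩

lemma isComplement_initial_id (A : C) : IsComplement (initial.to A) (𝟙 A) :=
  isComplement_iff.2 ⟨BinaryCofan.IsColimit.mk _ (fun _ g ↦ g)
    (fun _ _ ↦ initialIsInitial.hom_ext _ _) (fun _ _ ↦ Category.id_comp _)
    (fun _ _ _ _ h ↦ (Category.id_comp _).symm.trans h)⟩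

lemma isComplemented_initial_to (A : C) : IsComplemented (initial.to A) :=
  ⟨A, 𝟙 A, isComplement_initial_id A⟩

lemma isComplement_inl_inr (A B : C) :
    IsComplement (coprod.inl : A ⟶ A ⨿ B) (coprod.inr : B ⟶ A ⨿ B) :=
  isComplement_iff.2 ⟨coprodIsCoprod A B⟩

lemma IsComplement.isIso_desc {A A' B : C} {α : A ⟶ B} {α' : A' ⟶ B} (h : IsComplement α α') :
    IsIso (coprod.desc α α') := by
  have := h.mono_left
  have := h.mono_right
  obtain ⟨P, p, p', hP, ⟨hi⟩⟩ := h.inter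
  exact h.union _ (mono_desc hP hi) ⟨coprod.inl, coprod.inl_desc _ _⟩
    ⟨coprod.inr, coprod.inr_desc _ _⟩


/-- Complements are stable under pullback. -/
lemma IsComplement.of_isPullback {A A' B Y P P' : C} {α : A ⟶ B} {α' : A' ⟶ B} {f : Y ⟶ B}
    {p : P ⟶ Y} {q : P ⟶ A} {p' : P' ⟶ Y} {q' : P' ⟶ A'} (h : IsComplement α α')
    (hp : IsPullback p q f α) (hp' : IsPullback p' q' f α') : IsComplement p p' := by
  obtain ⟨k⟩ := isComplement_iff.1 h
  exact isComplement_iff.2 (((BinaryCofan.isVanKampen_iff _).1 (FinitaryExtensive.vanKampen _ k)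
    (BinaryCofan.mk p p') q q' f hp.w.symm hp'.w.symm).2 ⟨hp, hp'⟩)

lemma IsComplement.comp_iso {A A' B D : C} {α : A ⟶ B} {α' : A' ⟶ B} (h : IsComplement α α')
    (e : B ≅ D) : IsComplement (α ≫ e.hom) (α' ≫ e.hom) := by
  obtain ⟨k⟩ := isComplement_iff.1 h
  exact isComplement_iff.2 ⟨k.ofIsoColimit (BinaryCofan.ext e rfl rfl)⟩

/-- The complement of `A` in `D`, for `A` complemented in `B` and `B` complemented in `D`, is the
union of the two complements. -/
lemma IsComplement.comp {A A' B B' D : C} {α : A ⟶ B} {α' : A' ⟶ B} {β : B ⟶ D} {β' : B' ⟶ D}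
    (h : IsComplement α α') (k : IsComplement β β') :
    IsComplement (α ≫ β) (coprod.desc (α' ≫ β) β') := by
  obtain ⟨h⟩ := isComplement_iff.1 h
  obtain ⟨k⟩ := isComplement_iff.1 k
  choose m m₁ m₂ using @fun T (f : A ⟶ T) (g : A' ⨿ B' ⟶ T) ↦ cofan_desc h f (coprod.inl ≫ g)
  choose l l₁ l₂ using
    @fun T (f : A ⟶ T) (g : A' ⨿ B' ⟶ T) ↦ cofan_desc k (m T f g) (coprod.inr ≫ g)
  refine isComplement_iff.2 ⟨BinaryCofan.IsColimit.mk _ (fun {T} f g ↦ l T f g) (fun f g ↦ ?_)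
    (fun f g ↦ ?_) ?_⟩
  · change (α ≫ β) ≫ l _ f g = f
    rw [Category.assoc, l₁, m₁]
  · change coprod.desc (α' ≫ β) β' ≫ l _ f g = g
    apply coprod.hom_ext
    · rw [coprod.inl_desc_assoc, Category.assoc, l₁, m₂]
    · rw [coprod.inr_desc_assoc, l₂]
  · intro T f g (n : D ⟶ T) n₁ n₂
    change (α ≫ β) ≫ n = f at n₁
    change coprod.desc (α' ≫ β) β' ≫ n = g at n₂
    subst n₁ n₂
    apply cofan_ext k
    · apply cofan_ext h
      · rw [l₁, m₁, Category.assoc]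
      · rw [l₁, m₂, coprod.inl_desc_assoc, Category.assoc]
    · rw [l₂, coprod.inr_desc_assoc]

end complements

namespace PreOrd

/-! ### Trivial morphisms of preorders -/

section trivial

variable {C : Type u} [Category.{v} C]

/-- A morphism is trivial exactly when it identifies related elements: it then factors through the
discrete preorder on the underlying object of its codomain. -/
lemma isTrivial_iff [HasPullbacks C] {A B : PreOrd C} (f : A ⟶ B) :
    IsTrivial f ↔ A.r₁ ≫ f.f = A.r₂ ≫ f.f := by
  constructor
  · rintro ⟨Z, g, h, hZ, rfl⟩
    rw [isTrivialObj_iff] at hZ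
    rw [comp_f, ← Category.assoc, ← Category.assoc, comm1 g, comm2 g, hZ]
  · intro h
    obtain ⟨ρ⟩ := B.refl
    let Z : PreOrd C := ofElements (𝟙 B.X) (𝟙 B.X) (fun T s t h _ ↦ by simpa using h)
      ⟨𝟙 _, by simp, by simp⟩ (fun T s t h ↦ ⟨s, rfl, h⟩)
    exact ⟨Z, ⟨f.f, A.r₁ ≫ f.f, (Category.comp_id _).symm, h.symm.trans (Category.comp_id _).symm⟩,
      ⟨𝟙 B.X, ρ.r, (Category.comp_id _).trans ρ.reflexivity₁.symm,
        (Category.comp_id _).trans ρ.reflexivity₂.symm⟩,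
      (isTrivialObj_iff Z).2 rfl, hom_ext (Category.comp_id _)⟩

lemma IsTrivial.comp_left {A B D : PreOrd C} {f : B ⟶ D} (hf : IsTrivial f) (g : A ⟶ B) :
    IsTrivial (g ≫ f) := by
  obtain ⟨Z, a, b, hZ, rfl⟩ := hf
  exact ⟨Z, g ≫ a, b, hZ, Category.assoc _ _ _⟩

lemma IsTrivial.comp_right {A B D : PreOrd C} {f : A ⟶ B} (hf : IsTrivial f) (g : B ⟶ D) :
    IsTrivial (f ≫ g) := by
  obtain ⟨Z, a, b, hZ, rfl⟩ := hf
  exact ⟨Z, a, b ≫ g, hZ, (Category.assoc _ _ _).symm⟩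

lemma IsTrivial.of_comp [HasPullbacks C] {A B D : PreOrd C} {f : A ⟶ B} (g : B ⟶ D) [Mono g.f]
    (h : IsTrivial (f ≫ g)) : IsTrivial f := by
  rw [isTrivial_iff] at h ⊢
  rw [← cancel_mono g.f]
  simpa using h

lemma mono_of_mono_f {A B : PreOrd C} (g : A ⟶ B) [Mono g.f] : Mono g :=
  ⟨fun a b e ↦ hom_ext (by rw [← cancel_mono g.f]; exact congr(($e).f))⟩

/-- The kernel of `f` relative to trivial morphisms restricts the relation of `A` to the pairs
identified by `f`. -/
lemma exists_isZKernel [HasFiniteLimits C] {A B : PreOrd C} (f : A ⟶ B) :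
    ∃ (K : PreOrd C) (k : K ⟶ A), IsIso k.f ∧ IsZKernel k f := by
  let i := equalizer.ι (A.r₁ ≫ f.f) (A.r₂ ≫ f.f)
  have hi : i ≫ A.r₁ ≫ f.f = i ≫ A.r₂ ≫ f.f := equalizer.condition _ _
  have hl : ∀ {T : C} (s : T ⟶ A.R), s ≫ A.r₁ ≫ f.f = s ≫ A.r₂ ≫ f.f → ∃ t, t ≫ i = s :=
    fun s hs ↦ ⟨equalizer.lift s hs, equalizer.lift_ι _ _⟩
  let K : PreOrd C := ofElements (i ≫ A.r₁) (i ≫ A.r₂)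
    (by
      intro T s t h₁ h₂
      rw [← cancel_mono i]
      exact A.rel_ext (by simpa using h₁) (by simpa using h₂))
    (by
      obtain ⟨ρ⟩ := A.refl
      obtain ⟨t, ht⟩ := hl ρ.r (by rw [reassoc_of% ρ.reflexivity₁, reassoc_of% ρ.reflexivity₂])
      exact ⟨t, by rw [reassoc_of% ht, ρ.reflexivity₁], by rw [reassoc_of% ht, ρ.reflexivity₂]⟩)
    (by
      intro T s t h
      obtain ⟨w, w₁, w₂⟩ := A.trans_elt (s ≫ i) (t ≫ i) (by simpa using h)
      obtain ⟨u, hu⟩ := hl w (by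
        rw [reassoc_of% w₁, reassoc_of% w₂, hi, reassoc_of% h, hi])
      exact ⟨u, by rw [reassoc_of% hu, w₁, Category.assoc],
        by rw [reassoc_of% hu, w₂, Category.assoc]⟩)
  let k : K ⟶ A := ⟨𝟙 A.X, i, Category.comp_id _, Category.comp_id _⟩
  have hk : IsIso k.f := inferInstanceAs (IsIso (𝟙 A.X))
  have := mono_of_mono_f k
  refine ⟨K, k, hk, (isTrivial_iff _).2 ?_, ?_⟩
  · change (i ≫ A.r₁) ≫ 𝟙 A.X ≫ f.f = (i ≫ A.r₂) ≫ 𝟙 A.X ≫ f.f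
    simpa using hi
  · intro Y l h
    rw [isTrivial_iff] at h
    obtain ⟨t, ht⟩ := hl l.fhat (by
      rw [← Category.assoc, ← Category.assoc, ← comm1, ← comm2]; simpa using h)
    refine ⟨⟨l.f, t, ?_, ?_⟩, hom_ext (Category.comp_id _), fun y hy ↦ ?_⟩
    · exact (comm1 l).trans (by rw [← ht, Category.assoc]; rfl)
    · exact (comm2 l).trans (by rw [← ht, Category.assoc]; rfl)
    · rw [← cancel_mono k, hy]
      exact hom_ext (Category.comp_id _).symm

/-- By uniqueness, every kernel relative to trivial morphisms is invertible on underlying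
objects. -/
lemma IsZKernel.isIso_f [HasFiniteLimits C] {K A B : PreOrd C} {k : K ⟶ A} {f : A ⟶ B}
    (h : IsZKernel k f) : IsIso k.f := by
  obtain ⟨K', k', hk', h'⟩ := exists_isZKernel f
  obtain ⟨a, ha, -⟩ := h'.existsUnique_lift k h.isTrivial_comp
  obtain ⟨b, hb, -⟩ := h.existsUnique_lift k' h'.isTrivial_comp
  have hab : a ≫ b = 𝟙 K := (h.existsUnique_lift k h.isTrivial_comp).unique
    (by rw [Category.assoc, hb, ha]) (Category.id_comp _)
  have hba : b ≫ a = 𝟙 K' := (h'.existsUnique_lift k' h'.isTrivial_comp).unique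
    (by rw [Category.assoc, ha, hb]) (Category.id_comp _)
  have : IsIso a.f := ⟨b.f, congr(($hab).f), congr(($hba).f)⟩
  rw [← ha]
  exact inferInstanceAs (IsIso (a.f ≫ k'.f))

variable [FinitaryExtensive C] [HasPullbacks C]

lemma isTrivial_of_isInitial {A B : PreOrd C} (hA : IsInitial A) (f : A ⟶ B) : IsTrivial f :=
  ⟨empty C, hA.to _, (emptyIsInitial C).to B, (isTrivialObj_iff _).2 rfl, hA.hom_ext _ _⟩

lemma _root_.StableCat.IsComplement.mono_f {A A' B : PreOrd C} {α : A ⟶ B} {α' : A' ⟶ B}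
    (h : IsComplement α α') : Mono α.f :=
  FinitaryExtensive.mono_inl_of_isColimit (isColimit_iff.1 (isComplement_iff.1 h)).1.some

/-- Triviality may be tested on complementary subobjects, since the relation of a sum is the sum of
the relations. -/
lemma _root_.StableCat.IsComplement.isTrivial {A A' B D : PreOrd C} {α : A ⟶ B} {α' : A' ⟶ B}
    (h : IsComplement α α') {f : B ⟶ D} (hf : IsTrivial (α ≫ f)) (hf' : IsTrivial (α' ≫ f)) :
    IsTrivial f := by
  rw [isTrivial_iff] at *
  refine cofan_ext (isColimit_iff.1 (isComplement_iff.1 h)).2.some ?_ ?_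
  · rw [← Category.assoc, ← Category.assoc, ← comm1, ← comm2]; simpa using hf
  · rw [← Category.assoc, ← Category.assoc, ← comm1, ← comm2]; simpa using hf'

lemma isTrivial_coprod_desc {A B D : PreOrd C} {f : A ⟶ D} {g : B ⟶ D} (hf : IsTrivial f)
    (hg : IsTrivial g) : IsTrivial (coprod.desc f g) :=
  (isComplement_inl_inr A B).isTrivial (by rwa [coprod.inl_desc]) (by rwa [coprod.inr_desc])

instance coprod_map_f_isIso {A B A' B' : PreOrd C} (f : A ⟶ A') (g : B ⟶ B') [IsIso f.f]
    [IsIso g.f] : IsIso (coprod.map f g).f := by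
  obtain ⟨h⟩ := (isColimit_iff.1 ⟨coprodIsCoprod A B⟩).1
  obtain ⟨h'⟩ := (isColimit_iff.1 ⟨coprodIsCoprod A' B'⟩).1
  have e₁ : (coprod.inl : A ⟶ A ⨿ B).f ≫ (coprod.map f g).f = f.f ≫ (coprod.inl : A' ⟶ _).f :=
    congr(($(coprod.inl_map f g)).f)
  have e₂ : (coprod.inr : B ⟶ A ⨿ B).f ≫ (coprod.map f g).f = g.f ≫ (coprod.inr : B' ⟶ _).f :=
    congr(($(coprod.inr_map f g)).f)
  obtain ⟨l, l₁, l₂⟩ := cofan_desc h' (inv f.f ≫ (coprod.inl : A ⟶ A ⨿ B).f)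
    (inv g.f ≫ (coprod.inr : B ⟶ A ⨿ B).f)
  refine ⟨l, cofan_ext h ?_ ?_, cofan_ext h' ?_ ?_⟩
  · rw [reassoc_of% e₁, l₁]; simp
  · rw [reassoc_of% e₂, l₂]; simp
  · rw [reassoc_of% l₁, e₁]; simp
  · rw [reassoc_of% l₂, e₂]; simp

end trivial

end PreOrd

/-! ### Congruence diagrams -/

section congruence

open PreOrd PartialMaps

variable {C : Type u} [Category.{v} C]

namespace PreOrd

lemma CongruenceDiagram.w {A B : PreOrd C} {s t : PartialSpan A B} (D : CongruenceDiagram s t) :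
    D.α₁ ≫ s.ι = D.α₂ ≫ t.ι :=
  D.w₁.trans D.w₂.symm

variable [FinitaryExtensive C] [HasPullbacks C]

lemma CongruenceDiagram.nonempty_of {A B A₀ : PreOrd C} {s t : PartialSpan A B} {C₁ C₂ : PreOrd C}
    {α₁ : A₀ ⟶ s.dom} {α₂ : A₀ ⟶ t.dom} {γ₁ : C₁ ⟶ s.dom} {γ₂ : C₂ ⟶ t.dom}
    (w : α₁ ≫ s.ι = α₂ ≫ t.ι) (agree : α₁ ≫ s.f = α₂ ≫ t.f) (h₁ : IsComplement α₁ γ₁)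
    (h₂ : IsComplement α₂ γ₂) (t₁ : IsTrivial (γ₁ ≫ s.f)) (t₂ : IsTrivial (γ₂ ≫ t.f)) :
    Nonempty (CongruenceDiagram s t) :=
  ⟨⟨A₀, α₁ ≫ s.ι, α₁, α₂, IsComplemented.comp ⟨_, _, h₁⟩ s.isComplemented, rfl, w.symm, C₁, C₂,
    γ₁, γ₂, h₁, h₂, agree, t₁, t₂⟩⟩

/-- Suppose that `f` and `g` agree on `A₀`, that `f` is trivial off `A₀` and that `g` is trivial off
`E₀`. Then `f` is trivial off `A₀ ∩ E₀`. -/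
lemma exists_isComplement_isTrivial {A₀ E₀ C₁ E₁ P S T B : PreOrd C} {a₁ : A₀ ⟶ S} {a₂ : A₀ ⟶ T}
    {γ : C₁ ⟶ S} {b : E₀ ⟶ T} {δ : E₁ ⟶ T} {p : P ⟶ A₀} {q : P ⟶ E₀} {f : S ⟶ B} {g : T ⟶ B}
    (hP : IsPullback p q a₂ b) (ha : IsComplement a₁ γ) (hb : IsComplement b δ)
    (e : a₁ ≫ f = a₂ ≫ g) (hf : IsTrivial (γ ≫ f)) (hg : IsTrivial (δ ≫ g)) :
    ∃ (Q : PreOrd C) (c : Q ⟶ S), IsComplement (p ≫ a₁) c ∧ IsTrivial (c ≫ f) := by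
  have hQ := IsPullback.of_hasPullback a₂ δ
  refine ⟨_, _, (hb.of_isPullback hP hQ).comp ha, ?_⟩
  rw [coprod.desc_comp]
  refine isTrivial_coprod_desc ?_ hf
  rw [Category.assoc, e, hQ.w_assoc]
  exact hg.comp_left _

lemma CongruenceDiagram.trans {A B : PreOrd C} {s t w : PartialSpan A B}
    (D : CongruenceDiagram s t) (E : CongruenceDiagram t w) : Nonempty (CongruenceDiagram s w) := by
  have hP := IsPullback.of_hasPullback D.α₂ E.α₁
  obtain ⟨Q₁, c₁, h₁, t₁⟩ := exists_isComplement_isTrivial hP D.isComplement₁ E.isComplement₁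
    D.agree D.isTrivial₁ E.isTrivial₁
  obtain ⟨Q₂, c₂, h₂, t₂⟩ := exists_isComplement_isTrivial hP.flip E.isComplement₂ D.isComplement₂
    E.agree.symm E.isTrivial₂ D.isTrivial₂
  refine nonempty_of ?_ ?_ h₁ h₂ t₁ t₂
  · rw [Category.assoc, Category.assoc, D.w, ← E.w, hP.w_assoc]
  · rw [Category.assoc, Category.assoc, D.agree, ← E.agree, hP.w_assoc]

lemma CongruenceDiagram.symm {A B : PreOrd C} {s t : PartialSpan A B}
    (D : CongruenceDiagram s t) : Nonempty (CongruenceDiagram t s) :=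
  nonempty_of D.w.symm D.agree.symm D.isComplement₂ D.isComplement₁ D.isTrivial₂ D.isTrivial₁

/-- Spans representing the same partial map are congruent, with `A₀` the whole domain. -/
lemma CongruenceDiagram.of_setoid {A B : PreOrd C} {s t : PartialSpan A B}
    (h : PartialSpan.setoid A B s t) : Nonempty (CongruenceDiagram s t) := by
  obtain ⟨e, h₁, h₂⟩ := h
  have hi : IsComplement (𝟙 s.dom) (initial.to s.dom) := (isComplement_initial_id _).symm
  refine nonempty_of (α₁ := 𝟙 _) (α₂ := 𝟙 _ ≫ e.hom) ?_ ?_ hi (hi.comp_iso e)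
    (isTrivial_of_isInitial initialIsInitial _) (isTrivial_of_isInitial initialIsInitial _)
  · simp [h₁]
  · simp [h₂]

/-- Congruent spans remain congruent after precomposition: pull the whole diagram back. -/
lemma CongruenceDiagram.comp_left {A B D : PreOrd C} (u : PartialSpan A B) {s t : PartialSpan B D}
    (E : CongruenceDiagram s t) : Nonempty (CongruenceDiagram (u.comp s) (u.comp t)) := by
  have hP := IsPullback.of_hasPullback u.f E.α₀
  have key : ∀ {r : PartialSpan B D} {α : E.A₀ ⟶ r.dom} {Γ : PreOrd C} {γ : Γ ⟶ r.dom},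
      α ≫ r.ι = E.α₀ → IsComplement α γ → IsTrivial (γ ≫ r.f) →
      ∃ (a : pullback u.f E.α₀ ⟶ (u.comp r).dom) (Q : PreOrd C) (c : Q ⟶ (u.comp r).dom),
        a ≫ (u.comp r).ι = pullback.fst _ _ ≫ u.ι ∧
        a ≫ (u.comp r).f = pullback.snd _ _ ≫ α ≫ r.f ∧
        IsComplement a c ∧ IsTrivial (c ≫ (u.comp r).f) := by
    intro r α Γ γ hα h ht
    have hr := IsPullback.of_hasPullback u.f r.ι
    have hw : pullback.fst u.f E.α₀ ≫ u.f = (pullback.snd u.f E.α₀ ≫ α) ≫ r.ι := by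
      rw [Category.assoc, hα, hP.w]
    have hQ := IsPullback.of_hasPullback (pullback.snd u.f r.ι) γ
    have ha : IsPullback (hr.lift _ _ hw) (pullback.snd u.f E.α₀) (pullback.snd u.f r.ι) α := by
      refine IsPullback.of_right ?_ (hr.lift_snd _ _ hw) hr
      rwa [hr.lift_fst, hα]
    refine ⟨hr.lift _ _ hw, _, _, ?_, ?_, h.of_isPullback ha hQ, ?_⟩
    · exact hr.lift_fst_assoc _ _ _ _
    · exact (hr.lift_snd_assoc _ _ _ _).trans (Category.assoc _ _ _)
    · change IsTrivial (_ ≫ pullback.snd u.f r.ι ≫ r.f)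
      rw [hQ.w_assoc]
      exact ht.comp_left _
  obtain ⟨a₁, Q₁, c₁, i₁, j₁, h₁, t₁⟩ := key E.w₁ E.isComplement₁ E.isTrivial₁
  obtain ⟨a₂, Q₂, c₂, i₂, j₂, h₂, t₂⟩ := key E.w₂ E.isComplement₂ E.isTrivial₂
  exact nonempty_of (i₁.trans i₂.symm) (by rw [j₁, j₂, E.agree]) h₁ h₂ t₁ t₂

/-- Congruent spans remain congruent after postcomposition: pull the whole diagram back to the
preimages of the domain of the second factor. -/
lemma CongruenceDiagram.comp_right {A B D : PreOrd C} {s t : PartialSpan A B}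
    (E : CongruenceDiagram s t) (u : PartialSpan B D) :
    Nonempty (CongruenceDiagram (s.comp u) (t.comp u)) := by
  have key : ∀ {r : PartialSpan A B} {α : E.A₀ ⟶ r.dom} {Γ P : PreOrd C} {γ : Γ ⟶ r.dom}
      {p : P ⟶ E.A₀} {q : P ⟶ u.dom},
      IsPullback p q (α ≫ r.f) u.ι → IsComplement α γ → IsTrivial (γ ≫ r.f) →
      ∃ (a : P ⟶ (r.comp u).dom) (Q : PreOrd C) (c : Q ⟶ (r.comp u).dom),
        a ≫ (r.comp u).ι = p ≫ α ≫ r.ι ∧ a ≫ (r.comp u).f = q ≫ u.f ∧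
        IsComplement a c ∧ IsTrivial (c ≫ (r.comp u).f) := by
    intro r α Γ P γ p q hP h ht
    have hr := IsPullback.of_hasPullback r.f u.ι
    have hw : (p ≫ α) ≫ r.f = q ≫ u.ι := by rw [Category.assoc, hP.w]
    have hQ := IsPullback.of_hasPullback (pullback.fst r.f u.ι) γ
    have ha : IsPullback (hr.lift _ _ hw) p (pullback.fst r.f u.ι) α := by
      refine IsPullback.of_right ?_ (hr.lift_fst _ _ hw) hr.flip
      rw [hr.lift_snd]
      exact hP.flip
    obtain ⟨u', υ, hu⟩ := u.isComplemented
    have := hu.mono_f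
    refine ⟨hr.lift _ _ hw, _, _, ?_, ?_, h.of_isPullback ha hQ, ?_⟩
    · exact (hr.lift_fst_assoc _ _ _ _).trans (Category.assoc _ _ _)
    · exact hr.lift_snd_assoc _ _ _ _
    · change IsTrivial (_ ≫ pullback.snd r.f u.ι ≫ u.f)
      -- Triviality is cancelled along the domain inclusion `u.ι`, monic on underlying objects.
      rw [← Category.assoc]
      refine IsTrivial.comp_right (IsTrivial.of_comp u.ι ?_) _
      rw [Category.assoc, ← hr.w, hQ.w_assoc]
      exact ht.comp_left _
  have hP := IsPullback.of_hasPullback (E.α₁ ≫ s.f) u.ι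
  obtain ⟨a₁, Q₁, c₁, i₁, j₁, h₁, t₁⟩ := key hP E.isComplement₁ E.isTrivial₁
  obtain ⟨a₂, Q₂, c₂, i₂, j₂, h₂, t₂⟩ := key (by rwa [← E.agree]) E.isComplement₂ E.isTrivial₂
  exact nonempty_of (by rw [i₁, i₂, E.w]) (j₁.trans j₂.symm) h₁ h₂ t₁ t₂

end PreOrd

variable [FinitaryExtensive C] [HasPullbacks C]

lemma PartialMaps.homMk_surjective {A B : C} (p : (⟨A⟩ : PartialMaps C) ⟶ ⟨B⟩) :
    ∃ s : PartialSpan A B, homMk s = p := by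
  obtain ⟨s⟩ := p
  exact ⟨s, rfl⟩

/-- The relation on partial maps does not depend on the representatives: changes of representative
are themselves congruence diagrams, and these compose. -/
lemma congruenceRel_homMk_iff {A B : PreOrd C} {s t : PartialSpan A B} :
    congruenceRel C (homMk s) (homMk t) ↔ Nonempty (CongruenceDiagram s t) := by
  refine ⟨?_, fun h ↦ ⟨s, t, rfl, rfl, h⟩⟩
  rintro ⟨s', t', hs, ht, ⟨D⟩⟩
  obtain ⟨D₁⟩ := CongruenceDiagram.of_setoid (homMk_eq_iff.1 hs.symm)
  obtain ⟨D₂⟩ := CongruenceDiagram.of_setoid (homMk_eq_iff.1 ht)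
  obtain ⟨D₃⟩ := D₁.trans D
  exact D₃.trans D₂

instance : Congruence (congruenceRel C) where
  equivalence {X Y} :=
    { refl := fun p ↦ by
        obtain ⟨s, rfl⟩ := homMk_surjective p
        exact congruenceRel_homMk_iff.2 (CongruenceDiagram.of_setoid (homMk_eq_iff.1 rfl))
      symm := by
        rintro _ _ ⟨s, t, rfl, rfl, ⟨D⟩⟩
        exact ⟨t, s, rfl, rfl, D.symm⟩
      trans := by
        rintro _ _ _ ⟨s, t, rfl, rfl, ⟨D⟩⟩ ⟨t', w, ht, rfl, ⟨E⟩⟩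
        obtain ⟨F⟩ := congruenceRel_homMk_iff.1 ⟨t', w, ht, rfl, ⟨E⟩⟩
        exact ⟨s, w, rfl, rfl, D.trans F⟩ }
  comp_left := by
    rintro X Y Z p _ _ ⟨s, t, rfl, rfl, ⟨D⟩⟩
    obtain ⟨u, rfl⟩ := homMk_surjective p
    exact ⟨u.comp s, u.comp t, rfl, rfl, D.comp_left u⟩
  comp_right := by
    rintro X Y Z _ _ p ⟨s, t, rfl, rfl, ⟨D⟩⟩
    obtain ⟨u, rfl⟩ := homMk_surjective p
    exact ⟨s.comp u, t.comp u, rfl, rfl, D.comp_right u⟩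

end congruence

/-! ### Kernels in the stable category -/

namespace Stab

open PreOrd

section

variable {C : Type u} [Category.{v} C] [FinitaryExtensive C] [HasPullbacks C]

lemma homMk_eq_iff {A B : PreOrd C} {s t : PartialSpan A B} :
    homMk s.ι s.f s.isComplemented = homMk t.ι t.f t.isComplemented ↔
      Nonempty (CongruenceDiagram s t) :=
  (Quotient.functor_map_eq_iff (congruenceRel C) _ _).trans congruenceRel_homMk_iff

lemma homMk_surjective {A B : PreOrd C} (p : (sigma C).obj A ⟶ (sigma C).obj B) :
    ∃ (A' : PreOrd C) (α : A' ⟶ A) (f : A' ⟶ B) (hα : StableCat.IsComplemented α),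
      homMk α f hα = p := by
  obtain ⟨⟨s⟩⟩ := p
  exact ⟨s.dom, s.ι, s.f, s.isComplemented, rfl⟩

lemma homMk_comp_sigma_map {A A' B D : PreOrd C} (α : A' ⟶ A) (f : A' ⟶ B)
    (hα : StableCat.IsComplemented α) (g : B ⟶ D) :
    homMk α f hα ≫ (sigma C).map g = homMk α (f ≫ g) hα :=
  congr((Quotient.functor (congruenceRel C)).map
    $(Quotient.sound (PartialSpan.comp_rel_of_isPullback (s := ⟨A', α, f, hα⟩)
    (t := PartialSpan.ofHom g) (w := ⟨A', α, f ≫ g, hα⟩)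
    (p := 𝟙 A') (q := f) (isPullback_id_left _) (Category.id_comp _) rfl)))

lemma homMk_comp_homMk {A A' B B' D P : PreOrd C} {α : A' ⟶ A} {f : A' ⟶ B} {β : B' ⟶ B}
    {g : B' ⟶ D} {p : P ⟶ A'} {q : P ⟶ B'} (hα : StableCat.IsComplemented α)
    (hβ : StableCat.IsComplemented β) (h : IsPullback p q f β) :
    homMk α f hα ≫ homMk β g hβ = homMk (p ≫ α) (q ≫ g) ((hβ.of_isPullback h).comp hα) :=
  congr((Quotient.functor (congruenceRel C)).map
    $(Quotient.sound (PartialSpan.comp_rel_of_isPullback (s := ⟨A', α, f, hα⟩)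
    (t := ⟨B', β, g, hβ⟩) (w := ⟨P, p ≫ α, q ≫ g, (hβ.of_isPullback h).comp hα⟩) h rfl rfl)))

lemma sigma_map_comp_homMk {A B B' D P : PreOrd C} {f : A ⟶ B} {β : B' ⟶ B}
    {g : B' ⟶ D} {p : P ⟶ A} {q : P ⟶ B'} (hβ : StableCat.IsComplemented β)
    (h : IsPullback p q f β) :
    (sigma C).map f ≫ homMk β g hβ = homMk p (q ≫ g) (hβ.of_isPullback h) :=
  congr((Quotient.functor (congruenceRel C)).map
    $(Quotient.sound (PartialSpan.comp_rel_of_isPullback (s := PartialSpan.ofHom f)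
    (t := ⟨B', β, g, hβ⟩) (w := ⟨P, p, q ≫ g, hβ.of_isPullback h⟩) h (Category.comp_id _) rfl)))

/-- The zero morphism is represented by the nowhere defined partial map. -/
lemma homMk_initial (A B : PreOrd C) :
    homMk (initial.to A) (initial.to B) (isComplemented_initial_to A) = 0 := by
  rw [← Category.id_comp (initial.to B),
    ← homMk_comp_sigma_map _ _ (isComplemented_initial_to A),
    (isZero_sigma_initial C).eq_zero_of_src ((sigma C).map (initial.to B)), comp_zero]

lemma homMk_eq_zero_iff {A A' B : PreOrd C} (α : A' ⟶ A) (f : A' ⟶ B)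
    (hα : StableCat.IsComplemented α) : homMk α f hα = 0 ↔ IsTrivial f := by
  rw [← homMk_initial]
  refine (homMk_eq_iff (s := ⟨A', α, f, hα⟩) 
    (t := ⟨_, initial.to A, initial.to B, isComplemented_initial_to A⟩)).trans ⟨?_, fun h ↦ ?_⟩
  · rintro ⟨D⟩
    -- `A₀` maps to the strict initial object, so its complement in `A'` is everything.
    have := initialIsInitial.isIso_to D.α₂
    have := D.isComplement₁.isIso_of_isInitial (initialIsInitial.ofIso (asIso D.α₂).symm)
    have h := D.isTrivial₁.comp_left (inv D.γ₁)
    rwa [IsIso.inv_hom_id_assoc] at h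
  · exact CongruenceDiagram.nonempty_of (initialIsInitial.hom_ext _ _)
      (initialIsInitial.hom_ext _ _) (isComplement_initial_id A') (isComplement_initial_id _)
      (h.comp_left _)
      (isTrivial_of_isInitial initialIsInitial _)

/-- A morphism of preorders which is a monomorphism on underlying objects can be cancelled both from
equalities and from trivial composites, hence from congruence diagrams. -/
lemma mono_sigma_map {A B : PreOrd C} (m : A ⟶ B) [Mono m.f] : Mono ((sigma C).map m) := by
  have := mono_of_mono_f m
  constructor
  rintro ⟨⟨Y⟩⟩ p q e
  obtain ⟨Y₁, β, g, hβ, rfl⟩ := homMk_surjective (A := Y) p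
  obtain ⟨Y₂, β', g', hβ', rfl⟩ := homMk_surjective (A := Y) q
  erw [homMk_comp_sigma_map, homMk_comp_sigma_map] at e
  obtain ⟨D⟩ := (homMk_eq_iff (s := ⟨Y₁, β, g ≫ m, hβ⟩) (t := ⟨Y₂, β', g' ≫ m, hβ'⟩)).1 e
  refine (homMk_eq_iff (s := ⟨Y₁, β, g, hβ⟩) (t := ⟨Y₂, β', g', hβ'⟩)).2
    (CongruenceDiagram.nonempty_of D.w ?_ D.isComplement₁ D.isComplement₂ ?_ ?_)
  · rw [← cancel_mono m, Category.assoc, Category.assoc]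
    exact D.agree
  · exact IsTrivial.of_comp m (by rw [Category.assoc]; exact D.isTrivial₁)
  · exact IsTrivial.of_comp m (by rw [Category.assoc]; exact D.isTrivial₂)

end

variable {C : Type u} [Category.{v} C] [FinitaryExtensive C] [HasFiniteLimits C]

/-- The map `m : K ⨿ A'c ⟶ A` is invertible on underlying objects, hence monic in the stable
category. A partial map `g` into `A` killed by `⟨α, f⟩` factors through `m`: its part landing in `A'` lifts to
`K`, and its part landing in `A'c` needs no lifting. -/
lemma exists_isLimit_kernelFork {A A' A'c B K : PreOrd C} (α : A' ⟶ A) (f : A' ⟶ B)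
    (hα : StableCat.IsComplemented α) (αc : A'c ⟶ A) (h : IsComplement α αc) (k : K ⟶ A')
    (hk : IsZKernel k f) :
    ∃ w : (sigma C).map (coprod.map k (𝟙 A'c) ≫ coprod.desc α αc) ≫ homMk α f hα = 0,
      Nonempty (IsLimit (KernelFork.ofι _ w)) := by
  have := h.isIso_desc
  have := hk.isIso_f
  have : IsIso (𝟙 A'c : A'c ⟶ A'c).f := inferInstanceAs (IsIso (𝟙 A'c.X))
  let m := coprod.map k (𝟙 A'c) ≫ coprod.desc α αc
  have : IsIso (coprod.desc α αc).f := inferInstanceAs (IsIso ((forget C).map (coprod.desc α αc)))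
  have : IsIso m.f :=
    inferInstanceAs (IsIso ((coprod.map k (𝟙 A'c)).f ≫ (coprod.desc α αc).f))
  have hm := mono_sigma_map m
  -- `K` is the preimage of the domain `A'` under `m`.
  have hK : IsPullback (coprod.inl : K ⟶ K ⨿ A'c) k m α :=
    IsPullback.of_iso (isPullback_coprod_map k (𝟙 A'c)).1 (Iso.refl _) (Iso.refl _) (Iso.refl _)
      (asIso (coprod.desc α αc)) (by simp) (by simp) (by simp [m]) (by simp [coprod.inl_desc])
  have w : (sigma C).map m ≫ homMk α f hα = 0 := by
    rw [sigma_map_comp_homMk hα hK, homMk_eq_zero_iff]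
    exact hk.isTrivial_comp
  refine ⟨w, ⟨KernelFork.IsLimit.ofι' _ _ fun {Y} p hp ↦ Nonempty.some ?_⟩⟩
  obtain ⟨⟨Y⟩⟩ := Y
  obtain ⟨Y', β, g, hβ, rfl⟩ := homMk_surjective (A := Y) p
  -- Split the domain of `g` into the preimages of `A'` and of its complement.
  have h₁ := IsPullback.of_hasPullback g α
  have h₂ := IsPullback.of_hasPullback g αc
  obtain ⟨hY⟩ := isComplement_iff.1 (h.of_isPullback h₁ h₂)
  erw [homMk_comp_homMk hβ hα h₁, homMk_eq_zero_iff] at hp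
  obtain ⟨l, hl, -⟩ := hk.existsUnique_lift _ hp
  obtain ⟨n, n₁, n₂⟩ := cofan_desc hY (l ≫ coprod.inl) (pullback.snd g αc ≫ coprod.inr)
  have hn : n ≫ m = g := by
    apply cofan_ext hY
    · rw [reassoc_of% n₁, hK.w, reassoc_of% hl, h₁.w]
    · rw [reassoc_of% n₂, coprod.inr_map_assoc, coprod.inr_desc, Category.id_comp, h₂.w]
  refine ⟨⟨homMk β n hβ, ?_⟩⟩
  subst hn
  exact homMk_comp_sigma_map β n hβ m

end Stab

end StableCat

theorem mainTheorem5 (C : Type u) [Category.{v} C] [Pretopos C] :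
    HasKernels (Stab C) ∧
    ∀ {A A' A'c B : PreOrd C} (α : A' ⟶ A) (f : A' ⟶ B) (hα : StableCat.IsComplemented α)
      (αc : A'c ⟶ A), IsComplement α αc →
      IsIso (coprod.desc α αc) ∧
      (∃ (K : PreOrd C) (k : K ⟶ A'), PreOrd.IsZKernel k f) ∧
      ∀ {K : PreOrd C} (k : K ⟶ A'), PreOrd.IsZKernel k f →
        ∃ w : (Stab.sigma C).map (coprod.map k (𝟙 A'c) ≫ coprod.desc α αc) ≫
            Stab.homMk α f hα = 0,
          Nonempty (IsLimit (KernelFork.ofι _ w)) := by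
  refine ⟨⟨?_⟩, ?_⟩
  · rintro ⟨⟨A⟩⟩ ⟨⟨B⟩⟩ p
    obtain ⟨A', α, f, hα, rfl⟩ := Stab.homMk_surjective (A := A) (B := B) p
    obtain ⟨A'c, αc, h⟩ := id hα
    obtain ⟨K, k, -, hk⟩ := PreOrd.exists_isZKernel f
    obtain ⟨w, ⟨hw⟩⟩ := Stab.exists_isLimit_kernelFork α f hα αc h k hk
    exact ⟨⟨⟨_, hw⟩⟩⟩
  · intro A A' A'c B α f hα αc h
    obtain ⟨K, k, -, hk⟩ := PreOrd.exists_isZKernel f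
    exact ⟨h.isIso_desc, ⟨K, k, hk⟩, fun k hk ↦
      Stab.exists_isLimit_kernelFork α f hα αc h k hk⟩
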